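/- Let $(X_\alpha)_{\alpha\in A}$ be an arbitrary family of compact metric spaces, let $X=\prod_{\alpha\in A}X_\alpha$ carry the product topology, and let $\mathcal H(X)$ be the set of all homeomorphisms of $X$ onto itself, equipped with the compact-open topology. Then $\mathcal H(X)$ is an absolute extensor for zero-dimensional compact spaces; that is, for every compact Hausdorff space $Y$ having a base of clopen sets, every closed subset $P\subset Y$ and every continuous map $g:P\to\mathcal H(X)$, there is a continuous map $\widetilde g:Y\to\mathcal H(X)$ with $\widetilde g|_P=g$. -/

import Mathlib

universe w u v

/-- The compact-open topology on the group `X ≃ₜ X` of all (surjective) self-homeomorphisms of `X`: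
the subspace topology inherited from the space `C(X, X)`, which Mathlib equips with the
compact-open topology. -/
instance Homeomorph.compactOpen {X : Type*} [TopologicalSpace X] : TopologicalSpace (X ≃ₜ X) :=
  TopologicalSpace.induced (fun h : X ≃ₜ X => (⟨h, h.continuous⟩ : C(X, X))) inferInstance

/-- A space is zero-dimensional if its clopen subsets form a base of the topology. (For compact
Hausdorff spaces this is equivalent to covering dimension at most `0`.) -/
def IsZeroDimensional (Y : Type*) [TopologicalSpace Y] : Prop :=
  TopologicalSpace.IsTopologicalBasis {U : Set Y | IsClopen U}

/-- `Z` is an absolute extensor for zero-dimensional compact (Hausdorff) spaces: every continuous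
map from a closed subset of such a space `Y` into `Z` extends to a continuous map on all of `Y`.
The universe `w` of the test spaces `Y` is arbitrary. -/
def IsAbsoluteExtensorForZeroDimCompact (Z : Type u) [TopologicalSpace Z] : Prop :=
  ∀ (Y : Type w) [TopologicalSpace Y] [CompactSpace Y] [T2Space Y], IsZeroDimensional Y →
    ∀ (P : Set Y), IsClosed P → ∀ g : C(P, Z), ∃ G : C(Y, Z), ∀ y : P, G y = g y

/-!
A family of homeomorphisms of `X = ∏ X a` over `P` is extended to `Y` by adding countably many
coordinates at a time.

* A nonempty completely metrizable space is an absolute extensor for zero-dimensional compacta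
  (`isAbsoluteExtensorForZeroDimCompact_of_completeSpace`): a map on `P` is approximated by maps
  on `Y` that are corrected, on small clopen sets, by ever smaller amounts.
* A continuous map from `X` to a metric space depends on countably many coordinates
  (`exists_countable_dependsOn`). Hence every index lies in a countable set `C` of indices such
  that, for every set `B` of indices to which all `g p` and `(g p)⁻¹` restrict, they also restrict
  to `B ∪ C`.
* Suppose that the restriction of `g` to the partial product over `B` has been extended to `Y`, and
  let `D = C \ B`. Over a point of the `B`-product, `g p` acts on the metrizable compactum `∏_D` by
  homeomorphisms. So the new part of `g` is a continuous map from `P` to the space of families,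
  indexed by the `B`-product, of homeomorphisms of `∏_D`. This space is completely metrizable
  however large `B` is, since it is a closed subspace of a space of pairs of continuous maps from a
  compact space to `∏_D`. So the new part of `g` extends to `Y` as well
  (`PartialExtension.exists_extends`).
* Partial extensions can be glued along chains, because a map into a product is continuous as soon
  as its coordinates are. By Zorn's lemma there is a maximal one, and by the previous point it
  involves all coordinates.

Continuity into the homeomorphism group is handled through jointly continuous maps `P × X → X`.
For compact Hausdorff `P` and `X`, joint continuity of `g` implies that of the family of inverses,
so that the compact-open topology suffices although its definition does not mention inverses.
-/

open Set Topology Filter Uniformity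

/-! ### Complete metric spaces are absolute extensors for zero-dimensional compacta -/

theorem IsClopen.continuous_piecewise {Y Z : Type*} [TopologicalSpace Y] [TopologicalSpace Z]
    {U : Set Y} [∀ y, Decidable (y ∈ U)] (hU : IsClopen U) {f g : Y → Z} (hf : Continuous f)
    (hg : Continuous g) : Continuous (U.piecewise f g) :=
  hf.piecewise (by simp [hU.frontier_eq]) hg

/-- A continuous `f` that is `ε`-close to `g` on the closed set `P` can be moved by less than `ε`
so as to become `δ`-close to `g` on `P`: near `p ∈ P`, replace `f` by the constant `g p` on a small
clopen set, and combine finitely many such changes by compactness of `P`. -/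
theorem IsZeroDimensional.exists_dist_lt {Y Z : Type*} [TopologicalSpace Y] [CompactSpace Y]
    [MetricSpace Z] (hY : IsZeroDimensional Y) {P : Set Y} (hP : IsClosed P) (g : C(P, Z))
    (f : C(Y, Z)) {ε δ : ℝ} (hε : 0 < ε) (hδ : 0 < δ) (hf : ∀ p : P, dist (f p) (g p) < ε) :
    ∃ f' : C(Y, Z), (∀ p : P, dist (f' p) (g p) < δ) ∧ ∀ y, dist (f y) (f' y) < ε := by
  classical
  suffices h : ∃ f' : C(Y, Z), ∃ U : Set Y, IsClopen U ∧ P ⊆ U ∧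
      (∀ p : P, (p : Y) ∈ U → dist (f' p) (g p) < δ) ∧ ∀ y, dist (f y) (f' y) < ε by
    obtain ⟨f', U, -, hPU, h₁, h₂⟩ := h
    exact ⟨f', fun p => h₁ p (hPU p.2), h₂⟩
  refine hP.isCompact.induction_on (p := fun s => ∃ f' : C(Y, Z), ∃ U : Set Y, IsClopen U ∧ s ⊆ U ∧
      (∀ p : P, (p : Y) ∈ U → dist (f' p) (g p) < δ) ∧ ∀ y, dist (f y) (f' y) < ε) ?_ ?_ ?_ ?_
  · exact ⟨f, ∅, isClopen_empty, Subset.rfl, fun p hp => hp.elim, fun y => by simpa using hε⟩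
  · rintro s t hst ⟨f', U, hU, htU, h⟩
    exact ⟨f', U, hU, hst.trans htU, h⟩
  · rintro s t ⟨f₁, U₁, hU₁, hs, h₁, h₁'⟩ ⟨f₂, U₂, hU₂, ht, h₂, h₂'⟩
    refine ⟨⟨U₁.piecewise f₁ f₂, hU₁.continuous_piecewise f₁.continuous f₂.continuous⟩, U₁ ∪ U₂,
      hU₁.union hU₂, union_subset_union hs ht, fun p hp => ?_, fun y => ?_⟩
    · by_cases hp₁ : (p : Y) ∈ U₁
      · simpa [hp₁] using h₁ p hp₁
      · simpa [hp₁] using h₂ p (hp.resolve_left hp₁)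
    · by_cases hy : y ∈ U₁
      · simpa [hy] using h₁' y
      · simpa [hy] using h₂' y
  · intro p hp
    have hg : {q : P | dist (g ⟨p, hp⟩) (g q) < δ} ∈ 𝓝 (⟨p, hp⟩ : P) :=
      (isOpen_lt (by fun_prop) continuous_const).mem_nhds (by simpa using hδ)
    rw [nhds_subtype_eq_comap, mem_comap] at hg
    obtain ⟨W, hW, hWg⟩ := hg
    have hf' : {y | dist (f y) (g ⟨p, hp⟩) < ε} ∈ 𝓝 p :=
      (isOpen_lt (by fun_prop) continuous_const).mem_nhds (hf ⟨p, hp⟩)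
    obtain ⟨U, hU, hpU, hUW⟩ := hY.mem_nhds_iff.1 (inter_mem hW hf')
    refine ⟨U, mem_nhdsWithin_of_mem_nhds (hU.isOpen.mem_nhds hpU),
      ⟨U.piecewise (fun _ => g ⟨p, hp⟩) f, hU.continuous_piecewise continuous_const f.continuous⟩,
      U, hU, Subset.rfl, fun q hq => ?_, fun y => ?_⟩
    · simpa [hq] using hWg (hUW hq).1
    · by_cases hy : y ∈ U
      · simpa [hy] using (hUW hy).2
      · simpa [hy] using hε

/-- A nonempty complete metrizable uniform space is an absolute extensor for zero-dimensional
compact spaces. The extension is the limit of maps `f n` with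
`dist (f n p) (g p) < M / 2 ^ n` on `P`, each obtained from the previous one by
`IsZeroDimensional.exists_dist_lt`. -/
theorem isAbsoluteExtensorForZeroDimCompact_of_completeSpace {Z : Type*} [UniformSpace Z]
    [(𝓤 Z).IsCountablyGenerated] [T0Space Z] [CompleteSpace Z] [Nonempty Z] :
    IsAbsoluteExtensorForZeroDimCompact.{w} Z := by
  intro Y _ _ _ hY P hP g
  let := UniformSpace.metricSpace Z
  obtain ⟨z⟩ := ‹Nonempty Z›
  have : CompactSpace P := isCompact_iff_compactSpace.1 hP.isCompact
  -- The constant `z` lies at a finite distance `< M` from `g`; the distances are then halved.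
  obtain ⟨M, hM, hzM⟩ : ∃ M : ℝ, 0 < M ∧ ∀ p, dist z (g p) < M :=
    ⟨dist (ContinuousMap.const P z) g + 1, by positivity, fun p =>
      (ContinuousMap.dist_apply_le_dist (f := ContinuousMap.const P z) (g := g) p).trans_lt
        (lt_add_one _)⟩
  have hpos (n : ℕ) : 0 < M / 2 ^ n := by positivity
  choose! next h₁ h₂ using fun (n : ℕ) (f : C(Y, Z)) (hf : ∀ p : P, dist (f p) (g p) < M / 2 ^ n) =>
    hY.exists_dist_lt hP g f (hpos n) (hpos (n + 1)) hf
  let f : ℕ → C(Y, Z) := fun n => Nat.rec (ContinuousMap.const Y z) next n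
  have hf (n : ℕ) : ∀ p : P, dist (f n p) (g p) < M / 2 ^ n := by
    induction n with
    | zero => simpa [f] using hzM
    | succ n ih => exact h₁ n (f n) ih
  have hcauchy : CauchySeq f := by
    refine cauchySeq_of_le_geometric_two (C := 2 * M) fun n => ?_
    rw [mul_div_cancel_left₀ _ two_ne_zero, ContinuousMap.dist_le (hpos n).le]
    exact fun y => (h₂ n (f n) (hf n) y).le
  obtain ⟨G, hG⟩ := cauchySeq_tendsto_of_complete hcauchy
  refine ⟨G, fun p => tendsto_nhds_unique
    ((ContinuousEvalConst.continuous_eval_const (p : Y)).continuousAt.tendsto.comp hG) ?_⟩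
  rw [tendsto_iff_dist_tendsto_zero]
  refine squeeze_zero (fun _ => dist_nonneg) (fun n => (hf n p).le) ?_
  simpa [div_eq_mul_inv] using
    (tendsto_pow_atTop_nhds_zero_of_lt_one (by norm_num : (0 : ℝ) ≤ 2⁻¹)
      (by norm_num)).const_mul M

/-! ### Dependence on countably many coordinates -/

/-- By uniform continuity and the definition of the product uniformity, finitely many coordinates
determine the value up to `1 / (n + 1)`, for each `n`. -/
theorem exists_countable_dependsOn {A : Type*} {X : A → Type*} [∀ a, UniformSpace (X a)]
    [∀ a, CompactSpace (X a)] {M : Type*} [MetricSpace M] {f : (∀ a, X a) → M}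
    (hf : Continuous f) : ∃ s : Set A, s.Countable ∧ DependsOn f s := by
  have huc := CompactSpace.uniformContinuous_of_continuous hf
  have key (n : ℕ) : ∃ t : Finset A, ∀ x y : ∀ a, X a, (∀ a ∈ t, x a = y a) →
      dist (f x) (f y) < 1 / ((n : ℝ) + 1) := by
    have h := huc (Metric.dist_mem_uniformity (Nat.one_div_pos_of_nat (α := ℝ) (n := n)))
    rw [mem_map, Pi.uniformity, mem_iInf_finite] at h
    obtain ⟨t, ht⟩ := h
    refine ⟨t, fun x y hxy => ?_⟩
    have hle : 𝓟 {(x, y)} ≤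
        ⨅ a ∈ t, comap (fun z : (∀ a, X a) × (∀ a, X a) => (z.1 a, z.2 a)) (𝓤 (X a)) :=
      le_iInf₂ fun a ha => by
        rw [← map_le_iff_le_comap, map_principal, image_singleton, principal_singleton]
        exact pure_le_iff.2 fun s hs => mem_uniformity_of_eq hs (hxy a ha)
    exact hle ht rfl
  choose t ht using key
  refine ⟨⋃ n, t n, countable_iUnion fun n => (t n).countable_toSet, fun x y hxy => ?_⟩
  refine dist_le_zero.1 (le_of_forall_pos_lt_add fun ε hε => ?_)
  obtain ⟨n, hn⟩ := exists_nat_one_div_lt hε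
  rw [zero_add]
  exact (ht n x y fun a ha => hxy a (mem_iUnion.2 ⟨n, ha⟩)).trans hn

/-- A continuous map out of `P × ∏ X a` with values in a metric space depends, uniformly in `P`,
on countably many coordinates of the second factor: apply `exists_countable_dependsOn` to the
map from the product to the metric space of continuous maps on `P`. -/
theorem exists_countable_forall_dependsOn {A : Type*} {X : A → Type*} [∀ a, UniformSpace (X a)]
    [∀ a, CompactSpace (X a)] {P M : Type*} [TopologicalSpace P] [CompactSpace P] [MetricSpace M]
    {f : P → (∀ a, X a) → M} (hf : Continuous fun q : P × (∀ a, X a) => f q.1 q.2) :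
    ∃ s : Set A, s.Countable ∧ ∀ p, DependsOn (f p) s := by
  let F : C((∀ a, X a) × P, M) := ⟨fun q => f q.2 q.1, hf.comp continuous_swap⟩
  obtain ⟨s, hs, h⟩ := exists_countable_dependsOn F.curry.continuous
  exact ⟨s, hs, fun p x y hxy => DFunLike.congr_fun (h hxy) p⟩

theorem exists_countable_closed {A : Type*} {N : A → Set A} (hN : ∀ a, (N a).Countable) (a : A) :
    ∃ C : Set A, C.Countable ∧ a ∈ C ∧ ∀ b ∈ C, N b ⊆ C := by
  let S : ℕ → Set A := fun n => Nat.rec {a} (fun _ s => ⋃ b ∈ s, N b) n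
  have hS (n : ℕ) : (S n).Countable := by
    induction n with
    | zero => exact countable_singleton a
    | succ n ih => exact ih.biUnion fun b _ => hN b
  refine ⟨⋃ n, S n, countable_iUnion hS, mem_iUnion.2 ⟨0, rfl⟩, fun b hb c hc => ?_⟩
  obtain ⟨n, hn⟩ := mem_iUnion.1 hb
  exact mem_iUnion.2 ⟨n + 1, mem_biUnion hn hc⟩

/-! ### Families of homeomorphisms as continuous maps of two variables -/

section Families

variable {T X : Type*} [TopologicalSpace T] [TopologicalSpace X]

theorem continuous_uncurry_homeomorph [LocallyCompactSpace X] {g : T → X ≃ₜ X} (hg : Continuous g) :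
    Continuous fun q : T × X => g q.1 q.2 := by
  have h : Continuous fun t => (⟨g t, (g t).continuous⟩ : C(X, X)) :=
    continuous_induced_dom.comp hg
  exact ContinuousMap.continuous_uncurry_of_continuous ⟨_, h⟩

/-- The inverses form a jointly continuous family as well, because `(t, x) ↦ (t, g t x)` is a
continuous bijection of a compact Hausdorff space. -/
theorem continuous_uncurry_homeomorph_symm [CompactSpace T] [T2Space T] [CompactSpace X]
    [T2Space X] {g : T → X ≃ₜ X}
    (hg : Continuous g) : Continuous fun q : T × X => (g q.1).symm q.2 := by
  let e : T × X ≃ T × X :=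
    { toFun := fun q => (q.1, g q.1 q.2)
      invFun := fun q => (q.1, (g q.1).symm q.2)
      left_inv := fun q => by simp
      right_inv := fun q => by simp }
  have he : Continuous e := continuous_fst.prodMk (continuous_uncurry_homeomorph hg)
  exact continuous_snd.comp he.continuous_symm_of_equiv_compact_to_t2

theorem continuous_homeomorph_of_uncurry {g : T → X ≃ₜ X}
    (hg : Continuous fun q : T × X => g q.1 q.2) : Continuous g :=
  continuous_induced_rng.2 (ContinuousMap.curry ⟨_, hg⟩).continuous

end Families

/-! ### Extending families of homeomorphisms of a metrizable compactum -/

/-- Let `u p x` and `v p x` be inverse homeomorphisms of the compact metrizable space `K` that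
depend continuously on `p ∈ P` and on `x` in a compact space `E`. They extend to all `y ∈ Y`:
although `P × E` need not be zero-dimensional, the pairs `(u p, v p)` of maps `E × K → K` form a
complete metrizable space, and `P` maps into it. -/
theorem IsZeroDimensional.exists_extension_fiberwise_inverse {E K : Type*} [TopologicalSpace E]
    [CompactSpace E] [T2Space E] [UniformSpace K] [CompactSpace K] [T2Space K]
    [(𝓤 K).IsCountablyGenerated] {Y : Type w} [TopologicalSpace Y] [CompactSpace Y] [T2Space Y]
    (hY : IsZeroDimensional Y) {P : Set Y} (hP : IsClosed P) (u v : C(P × (E × K), K))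
    (huv : ∀ p x k, u (p, x, v (p, x, k)) = k) (hvu : ∀ p x k, v (p, x, u (p, x, k)) = k) :
    ∃ U V : C(Y × (E × K), K), (∀ (p : P) x k, U (p, x, k) = u (p, x, k)) ∧
      (∀ y x k, U (y, x, V (y, x, k)) = k) ∧ ∀ y x k, V (y, x, U (y, x, k)) = k := by
  let S : Set (C(E × K, K) × C(E × K, K)) :=
    {q | ∀ x k, q.1 (x, q.2 (x, k)) = k ∧ q.2 (x, q.1 (x, k)) = k}
  have hS : IsClosed S := by
    simp only [S, ofPred_forall, ofPred_and]
    exact isClosed_iInter fun x => isClosed_iInter fun k =>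
      (isClosed_eq (by fun_prop) continuous_const).inter
        (isClosed_eq (by fun_prop) continuous_const)
  have : CompleteSpace S := hS.completeSpace_coe
  have : Nonempty S := ⟨(ContinuousMap.snd, ContinuousMap.snd), fun x k => ⟨rfl, rfl⟩⟩
  have : (𝓤 S).IsCountablyGenerated := inferInstanceAs (comap _ _).IsCountablyGenerated
  obtain ⟨G, hG⟩ := isAbsoluteExtensorForZeroDimCompact_of_completeSpace (Z := S) Y hY P hP
    ⟨fun p => ⟨(u.curry p, v.curry p), fun x k => ⟨huv p x k, hvu p x k⟩⟩, by fun_prop⟩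
  refine ⟨(ContinuousMap.mk (fun y => (G y).1.1)).uncurry,
    (ContinuousMap.mk (fun y => (G y).1.2)).uncurry, fun p x k => ?_, fun y x k => ?_,
    fun y x k => ?_⟩
  · change (G p).1.1 (x, k) = _
    rw [hG]
    rfl
  · exact ((G y).2 x k).1
  · exact ((G y).2 x k).2

/-! ### Changing some coordinates of a point -/

section Overwrite

variable {A : Type*} {X : A → Type*}

open Classical in
/-- The point with the coordinates of `k` in `D` and those of `x` elsewhere. -/
noncomputable def overwrite {D : Set A} (x : ∀ a, X a) (k : ∀ a : D, X a) : ∀ a, X a :=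
  fun a => if h : a ∈ D then k ⟨a, h⟩ else x a

theorem overwrite_of_mem {D : Set A} (x : ∀ a, X a) (k : ∀ a : D, X a) {a : A} (h : a ∈ D) :
    overwrite x k a = k ⟨a, h⟩ :=
  dif_pos h

theorem overwrite_of_notMem {D : Set A} (x : ∀ a, X a) (k : ∀ a : D, X a) {a : A} (h : a ∉ D) :
    overwrite x k a = x a :=
  dif_neg h

theorem continuous_overwrite [∀ a, TopologicalSpace (X a)] (D : Set A) :
    Continuous fun q : (∀ a, X a) × (∀ a : D, X a) => overwrite q.1 q.2 := by
  refine continuous_pi fun a => ?_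
  by_cases h : a ∈ D
  · simp only [overwrite_of_mem _ _ h]
    fun_prop
  · simp only [overwrite_of_notMem _ _ h]
    fun_prop

end Overwrite

/-! ### Partial extensions -/

section PartialExtension

variable {A : Type u} {X : A → Type v} [∀ a, TopologicalSpace (X a)] {Y : Type w}
  [TopologicalSpace Y] {P : Set Y}

/-- An extension over `Y` of what the family `g` of homeomorphisms of `∏ X a` does to the
coordinates in a set `support` of indices. It stands for a continuous family of homeomorphisms of
the partial product over `support`. To avoid partial products, the homeomorphisms and their
inverses are given by their coordinate functions on the full product, which are required to
depend on the coordinates in `support` only; coordinate functions outside `support` are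
irrelevant. Think of `N a` as a set of coordinates on which the `a`-th coordinates of
all `g p` and `(g p)⁻¹` depend: if it is contained in `support` for all `a ∈ support`, then
`g p` induces a homeomorphism of the partial product. -/
structure PartialExtension (g : P → (∀ a, X a) ≃ₜ (∀ a, X a)) (N : A → Set A) where
  /-- The coordinates taken care of. -/
  support : Set A
  subset_support : ∀ a ∈ support, N a ⊆ support
  /-- The coordinate functions of the homeomorphisms. -/
  toFun : ∀ a, C(Y × (∀ a, X a), X a)
  /-- The coordinate functions of the inverse homeomorphisms. -/
  invFun : ∀ a, C(Y × (∀ a, X a), X a)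
  dependsOn_toFun : ∀ a ∈ support, ∀ y, DependsOn (fun x => toFun a (y, x)) support
  dependsOn_invFun : ∀ a ∈ support, ∀ y, DependsOn (fun x => invFun a (y, x)) support
  left_inv : ∀ a ∈ support, ∀ y x, invFun a (y, fun b => toFun b (y, x)) = x a
  right_inv : ∀ a ∈ support, ∀ y x, toFun a (y, fun b => invFun b (y, x)) = x a
  toFun_coe : ∀ a ∈ support, ∀ (p : P) x, toFun a (p, x) = g p x a

namespace PartialExtension

variable {g : P → (∀ a, X a) ≃ₜ (∀ a, X a)} {N : A → Set A}

/-- `t` extends `s`: it has a larger support and agrees with `s` on the support of `s`. -/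
def Extends (s t : PartialExtension g N) : Prop :=
  s.support ⊆ t.support ∧
    ∀ a ∈ s.support, t.toFun a = s.toFun a ∧ t.invFun a = s.invFun a

theorem Extends.trans {s t r : PartialExtension g N} (hst : s.Extends t) (htr : t.Extends r) :
    s.Extends r :=
  ⟨hst.1.trans htr.1, fun a ha => ⟨(htr.2 a (hst.1 ha)).1.trans (hst.2 a ha).1,
    (htr.2 a (hst.1 ha)).2.trans (hst.2 a ha).2⟩⟩

/-- A chain of partial extensions has an upper bound, whose coordinate functions are taken from
any member of the chain that has the coordinate in its support. -/
theorem exists_upper_bound {c : Set (PartialExtension g N)} (hc : IsChain Extends c) :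
    ∃ t : PartialExtension g N, ∀ s ∈ c, s.Extends t := by
  classical
  let proj : ∀ a, C(Y × (∀ a, X a), X a) := fun a => ⟨fun q => q.2 a, by fun_prop⟩
  let F : ∀ a, C(Y × (∀ a, X a), X a) := fun a =>
    if h : ∃ s ∈ c, a ∈ s.support then h.choose.toFun a else proj a
  let F' : ∀ a, C(Y × (∀ a, X a), X a) := fun a =>
    if h : ∃ s ∈ c, a ∈ s.support then h.choose.invFun a else proj a
  have hF : ∀ s ∈ c, ∀ a ∈ s.support, F a = s.toFun a ∧ F' a = s.invFun a := by
    intro s hs a ha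
    have h : ∃ s ∈ c, a ∈ s.support := ⟨s, hs, ha⟩
    simp only [F, F', dif_pos h]
    obtain ⟨hs', ha'⟩ := h.choose_spec
    by_cases heq : h.choose = s
    · simp [heq]
    · rcases hc hs' hs heq with hle | hle
      · exact ⟨((hle.2 a ha').1).symm, ((hle.2 a ha').2).symm⟩
      · exact hle.2 a ha
  refine ⟨{
    support := ⋃ s ∈ c, s.support
    subset_support := ?_
    toFun := F
    invFun := F'
    dependsOn_toFun := ?_
    dependsOn_invFun := ?_
    left_inv := ?_
    right_inv := ?_
    toFun_coe := ?_ }, fun s hs => ⟨subset_biUnion_of_mem (u := fun s => s.support) hs, hF s hs⟩⟩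
  all_goals
    intro a ha
    obtain ⟨s, hs, ha⟩ := mem_iUnion₂.1 ha
  · exact (s.subset_support a ha).trans (subset_biUnion_of_mem (u := fun s => s.support) hs)
  · intro y x x' h
    simp only [(hF s hs a ha).1]
    exact s.dependsOn_toFun a ha y fun b hb => h b (mem_biUnion hs hb)
  · intro y x x' h
    simp only [(hF s hs a ha).2]
    exact s.dependsOn_invFun a ha y fun b hb => h b (mem_biUnion hs hb)
  · intro y x
    rw [(hF s hs a ha).2, ← s.left_inv a ha y x]
    exact s.dependsOn_invFun a ha y fun b hb => by rw [(hF s hs b hb).1]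
  · intro y x
    rw [(hF s hs a ha).1, ← s.right_inv a ha y x]
    exact s.dependsOn_toFun a ha y fun b hb => by rw [(hF s hs b hb).2]
  · intro p x
    rw [(hF s hs a ha).1, s.toFun_coe a ha]

end PartialExtension

end PartialExtension

/-! ### Adding countably many coordinates -/

namespace PartialExtension

variable {A : Type u} {X : A → Type v} [∀ a, MetricSpace (X a)] [∀ a, CompactSpace (X a)]
  {Y : Type w} [TopologicalSpace Y] {P : Set Y} {g : P → (∀ a, X a) ≃ₜ (∀ a, X a)} {N : A → Set A}

/-- The support can be enlarged by a countable set `D` of coordinates. Over a point `x` of the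
partial product over the old support, `g p` acts on the coordinates in `D` by a homeomorphism of
the compact metrizable space `∏ a : D, X a`; these homeomorphisms are extended
by `IsZeroDimensional.exists_extension_fiberwise_inverse`. -/
theorem exists_extends [CompactSpace Y] [T2Space Y] (hY : IsZeroDimensional Y) (hP : IsClosed P)
    (hg : Continuous fun q : P × (∀ a, X a) => g q.1 q.2)
    (hg' : Continuous fun q : P × (∀ a, X a) => (g q.1).symm q.2)
    (hN : ∀ a p, DependsOn (fun x => g p x a) (N a))
    (hN' : ∀ a p, DependsOn (fun x => (g p).symm x a) (N a)) (x₀ : ∀ a, X a)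
    (s : PartialExtension g N) {D : Set A} (hD : D.Countable) (hsD : Disjoint s.support D)
    (hND : ∀ a ∈ D, N a ⊆ s.support ∪ D) :
    ∃ t : PartialExtension g N, s.Extends t ∧ t.support = s.support ∪ D := by
  classical
  have : Countable D := hD.to_subtype
  have hB {a : A} (ha : a ∈ s.support) : a ∉ D := hsD.notMem_of_mem_left ha
  have hNS : ∀ a ∈ s.support ∪ D, N a ⊆ s.support ∪ D := fun a ha =>
    ha.elim (fun h => (s.subset_support a h).trans subset_union_left) (hND a)
  have hcongr {p : P} {x x' : ∀ a, X a} (h : ∀ a ∈ s.support ∪ D, x a = x' a) :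
      ∀ a ∈ s.support ∪ D, g p x a = g p x' a := fun a ha =>
    hN a p fun b hb => h b (hNS a ha hb)
  have hcongr' {p : P} {x x' : ∀ a, X a} (h : ∀ a ∈ s.support ∪ D, x a = x' a) :
      ∀ a ∈ s.support ∪ D, (g p).symm x a = (g p).symm x' a := fun a ha =>
    hN' a p fun b hb => h b (hNS a ha hb)
  have hcongrB {p : P} {x x' : ∀ a, X a} (h : ∀ a ∈ s.support, x a = x' a) :
      ∀ a ∈ s.support, g p x a = g p x' a := fun a ha =>
    hN a p fun b hb => h b (s.subset_support a ha hb)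
  have hcongrB' {p : P} {x x' : ∀ a, X a} (h : ∀ a ∈ s.support, x a = x' a) :
      ∀ a ∈ s.support, (g p).symm x a = (g p).symm x' a := fun a ha =>
    hN' a p fun b hb => h b (s.subset_support a ha hb)
  have hover := continuous_overwrite (X := X) D
  -- `u (p, x, ·)` is the action of `g p` on the coordinates in `D` over the point `x`. Its inverse
  -- `v (p, x, ·)` is the action of `(g p)⁻¹` over `g p x`, the image of `x` in the partial product.
  let u : C(P × ((∀ a, X a) × (∀ a : D, X a)), ∀ a : D, X a) :=
    ⟨fun q a => g q.1 (overwrite q.2.1 q.2.2) a, continuous_pi fun a =>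
      (continuous_apply (a : A)).comp (hg.comp (continuous_fst.prodMk (hover.comp continuous_snd)))⟩
  let v : C(P × ((∀ a, X a) × (∀ a : D, X a)), ∀ a : D, X a) :=
    ⟨fun q a => (g q.1).symm (overwrite (g q.1 q.2.1) q.2.2) a, continuous_pi fun a =>
      (continuous_apply (a : A)).comp (hg'.comp (continuous_fst.prodMk (hover.comp
        ((hg.comp (continuous_fst.prodMk (continuous_fst.comp continuous_snd))).prodMk
          (continuous_snd.comp continuous_snd)))))⟩
  have huv (p : P) (x : ∀ a, X a) (k : ∀ a : D, X a) : u (p, x, v (p, x, k)) = k := by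
    funext a
    have h : ∀ b ∈ s.support ∪ D,
        overwrite x (v (p, x, k)) b = (g p).symm (overwrite (g p x) k) b := by
      intro b hb
      by_cases hbD : b ∈ D
      · exact overwrite_of_mem _ _ hbD
      · have hbs := hb.resolve_right hbD
        rw [overwrite_of_notMem _ _ hbD]
        conv_lhs => rw [← (g p).symm_apply_apply x]
        exact hcongrB' (fun c hc => (overwrite_of_notMem _ _ (hB hc)).symm) b hbs
    refine (hcongr h a (Or.inr a.2)).trans ?_
    rw [Homeomorph.apply_symm_apply, overwrite_of_mem _ _ a.2]
  have hvu (p : P) (x : ∀ a, X a) (k : ∀ a : D, X a) : v (p, x, u (p, x, k)) = k := by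
    funext a
    have h : ∀ b ∈ s.support ∪ D,
        overwrite (g p x) (u (p, x, k)) b = g p (overwrite x k) b := by
      intro b hb
      by_cases hbD : b ∈ D
      · exact overwrite_of_mem _ _ hbD
      · rw [overwrite_of_notMem _ _ hbD]
        exact hcongrB (fun c hc => (overwrite_of_notMem _ _ (hB hc)).symm) b
          (hb.resolve_right hbD)
    refine (hcongr' h a (Or.inr a.2)).trans ?_
    rw [Homeomorph.symm_apply_apply, overwrite_of_mem _ _ a.2]
  obtain ⟨U, V, hU, hUV, hVU⟩ := hY.exists_extension_fiberwise_inverse hP u v huv hvu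
  -- `U` and `V` may depend on all coordinates of the base point; resetting those outside the
  -- old support to the values in `x₀` makes them functions on the partial product.
  let r : (∀ a, X a) → ∀ a, X a := fun x => overwrite x₀ (D := s.support) fun a => x a
  have hr : Continuous r := (continuous_overwrite s.support).comp
    (continuous_const.prodMk (continuous_pi fun a => continuous_apply (a : A)))
  have hr_mem (x : ∀ a, X a) {a : A} (ha : a ∈ s.support) : r x a = x a :=
    overwrite_of_mem _ _ ha
  have hr_congr {x x' : ∀ a, X a} (h : ∀ a ∈ s.support, x a = x' a) : r x = r x' := by
    have : (fun a : s.support => x a) = fun a : s.support => x' a := funext fun a => h a a.2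
    simp only [r, this]
  let res : (∀ a, X a) → ∀ a : D, X a := fun x a => x a
  have hres : Continuous res := by fun_prop
  have hres_congr {x x' : ∀ a, X a} (h : ∀ a ∈ s.support ∪ D, x a = x' a) : res x = res x' :=
    funext fun a => h a (Or.inr a.2)
  -- The new inverse acts over `z` by the `V` of the preimage of `z` in the partial product, which
  -- is the restriction of `Finv (y, z)`.
  let Finv : Y × (∀ a, X a) → ∀ a, X a := fun q a => s.invFun a q
  have hFinv : Continuous Finv := by fun_prop
  have hFinv_congr {y : Y} {x x' : ∀ a, X a} (h : ∀ a ∈ s.support, x a = x' a) :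
      ∀ a ∈ s.support, Finv (y, x) a = Finv (y, x') a := fun a ha =>
    s.dependsOn_invFun a ha y h
  let F : ∀ a, C(Y × (∀ a, X a), X a) := fun a =>
    if h : a ∈ D then ⟨fun q => U (q.1, r q.2, res q.2) ⟨a, h⟩, by fun_prop⟩ else s.toFun a
  let F' : ∀ a, C(Y × (∀ a, X a), X a) := fun a =>
    if h : a ∈ D then ⟨fun q => V (q.1, r (Finv q), res q.2) ⟨a, h⟩, by fun_prop⟩
    else s.invFun a
  have hF {a : A} (ha : a ∈ s.support) : F a = s.toFun a := dif_neg (hB ha)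
  have hF' {a : A} (ha : a ∈ s.support) : F' a = s.invFun a := dif_neg (hB ha)
  have hFD {a : A} (ha : a ∈ D) (y : Y) (x : ∀ a, X a) :
      F a (y, x) = U (y, r x, res x) ⟨a, ha⟩ := by simp [F, ha]
  have hFD' {a : A} (ha : a ∈ D) (y : Y) (x : ∀ a, X a) :
      F' a (y, x) = V (y, r (Finv (y, x)), res x) ⟨a, ha⟩ := by simp [F', ha]
  refine ⟨{
    support := s.support ∪ D
    subset_support := hNS
    toFun := F
    invFun := F'
    dependsOn_toFun := ?_
    dependsOn_invFun := ?_
    left_inv := ?_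
    right_inv := ?_
    toFun_coe := ?_ }, ⟨subset_union_left, fun a ha => ⟨hF ha, hF' ha⟩⟩, rfl⟩
  · rintro a (ha | ha) y x x' h
    · simp only [hF ha]
      exact s.dependsOn_toFun a ha y fun b hb => h b (Or.inl hb)
    · simp only [hFD ha]
      rw [hr_congr fun b hb => h b (Or.inl hb), hres_congr h]
  · rintro a (ha | ha) y x x' h
    · simp only [hF' ha]
      exact s.dependsOn_invFun a ha y fun b hb => h b (Or.inl hb)
    · simp only [hFD' ha]
      rw [hr_congr (hFinv_congr fun b hb => h b (Or.inl hb)), hres_congr h]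
  · intro a ha y x
    have hinv : ∀ b ∈ s.support, Finv (y, fun b => F b (y, x)) b = x b := fun b hb =>
      (hFinv_congr (fun c hc => by rw [hF hc]) b hb).trans (s.left_inv b hb y x)
    rcases ha with ha | ha
    · rw [hF' ha]
      exact hinv a ha
    · have hD : res (fun b => F b (y, x)) = U (y, r x, res x) := funext fun b => hFD b.2 y x
      rw [hFD' ha, hr_congr hinv, hD, hVU]
  · intro a ha y x
    have hinv : ∀ b ∈ s.support, F' b (y, x) = Finv (y, x) b := fun b hb => by rw [hF' hb]
    rcases ha with ha | ha
    · rw [hF ha]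
      exact (s.dependsOn_toFun a ha y hinv).trans (s.right_inv a ha y x)
    · have hD : res (fun b => F' b (y, x)) = V (y, r (Finv (y, x)), res x) :=
        funext fun b => hFD' b.2 y x
      rw [hFD ha, hr_congr hinv, hD, hUV]
  · rintro a (ha | ha) p x
    · rw [hF ha, s.toFun_coe a ha]
    · rw [hFD ha, hU]
      refine hcongr (fun b hb => ?_) a (Or.inr ha)
      by_cases hbD : b ∈ D
      · exact overwrite_of_mem _ _ hbD
      · exact (overwrite_of_notMem _ _ hbD).trans (hr_mem x (hb.resolve_right hbD))

theorem exists_support_eq_univ [CompactSpace Y] [T2Space Y] (hY : IsZeroDimensional Y)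
    (hP : IsClosed P) (hg : Continuous fun q : P × (∀ a, X a) => g q.1 q.2)
    (hg' : Continuous fun q : P × (∀ a, X a) => (g q.1).symm q.2)
    (hNc : ∀ a, (N a).Countable) (hN : ∀ a p, DependsOn (fun x => g p x a) (N a))
    (hN' : ∀ a p, DependsOn (fun x => (g p).symm x a) (N a)) (x₀ : ∀ a, X a) :
    ∃ s : PartialExtension g N, s.support = univ := by
  obtain ⟨s, hs⟩ := exists_maximal_of_chains_bounded
    (fun c hc => exists_upper_bound (g := g) (N := N) hc) Extends.trans
  refine ⟨s, eq_univ_of_forall fun a => ?_⟩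
  obtain ⟨C, hC, haC, hNC⟩ := exists_countable_closed hNc a
  obtain ⟨t, hst, ht⟩ := s.exists_extends hY hP hg hg' hN hN' x₀ (hC.mono sdiff_subset)
    disjoint_sdiff_right (fun b hb => by
      rw [union_sdiff_self]
      exact (hNC b hb.1).trans subset_union_right)
  rw [union_sdiff_self] at ht
  exact (hs t hst).1 (ht ▸ Or.inr haC)

end PartialExtension

/-! ### Homeomorphism groups of products -/

theorem theorem3p4 {A : Type u} (X : A → Type v) [∀ a, MetricSpace (X a)]
    [∀ a, CompactSpace (X a)] :
    IsAbsoluteExtensorForZeroDimCompact.{w} ((∀ a, X a) ≃ₜ (∀ a, X a)) := by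
  intro Y _ _ _ hY P hP g
  rcases isEmpty_or_nonempty (∀ a, X a) with hX | ⟨⟨x₀⟩⟩
  · exact ⟨ContinuousMap.const Y (Homeomorph.refl _), fun p => Homeomorph.ext fun x => hX.elim x⟩
  have : CompactSpace P := isCompact_iff_compactSpace.1 hP.isCompact
  have hg := continuous_uncurry_homeomorph g.continuous
  have hg' := continuous_uncurry_homeomorph_symm g.continuous
  choose N₁ hN₁c hN₁ using fun a =>
    exists_countable_forall_dependsOn (f := fun p x => g p x a) ((continuous_apply a).comp hg)
  choose N₂ hN₂c hN₂ using fun a =>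
    exists_countable_forall_dependsOn (f := fun p x => (g p).symm x a)
      ((continuous_apply a).comp hg')
  obtain ⟨s, hs⟩ := PartialExtension.exists_support_eq_univ (g := g) (N := fun a => N₁ a ∪ N₂ a)
    hY hP hg hg' (fun a => (hN₁c a).union (hN₂c a))
    (fun a p x x' h => hN₁ a p fun b hb => h b (Or.inl hb))
    (fun a p x x' h => hN₂ a p fun b hb => h b (Or.inr hb)) x₀
  have hmem (a : A) : a ∈ s.support := hs ▸ mem_univ a
  refine ⟨⟨fun y =>
    { toFun := fun x a => s.toFun a (y, x)
      invFun := fun x a => s.invFun a (y, x)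
      left_inv := fun x => funext fun a => s.left_inv a (hmem a) y x
      right_inv := fun x => funext fun a => s.right_inv a (hmem a) y x },
    continuous_homeomorph_of_uncurry (continuous_pi fun a => (s.toFun a).continuous)⟩,
    fun p => Homeomorph.ext fun x => funext fun a => s.toFun_coe a (hmem a) p x⟩
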